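/- Let $(R,\mathfrak m)$ be a commutative Noetherian local ring, and let $I$ be an integrally closed $\mathfrak m$-primary ideal of $R$; that is, $I$ is a primary ideal with radical $\mathfrak m$, and $I$ contains every $x \in R$ that satisfies an equation $x^n + a_1x^{n-1} + \cdots + a_n = 0$ with $n \ge 1$ and $a_i \in I^i$ for $1 \le i \le n$. Then $R$ is regular if and only if the projective dimension $\operatorname{pd}_R(I)$ is finite; moreover, $\operatorname{pd}_R(I) < \infty$ if and only if $\operatorname{pd}_R(R/I) < \infty$. (The zero module is regarded as having projective dimension $-\infty$, hence $<\infty$.) -/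

import Mathlib

/-- An element `x` of `R` is integral over the ideal `I` if it satisfies an equation
`x ^ n + a₁ * x ^ (n - 1) + ⋯ + aₙ = 0` with `n ≥ 1` and `aᵢ ∈ I ^ i` for `i = 1, …, n`. -/
def Ideal.IsIntegralElem {R : Type*} [CommRing R] (I : Ideal R) (x : R) : Prop :=
  ∃ n : ℕ, 1 ≤ n ∧ ∃ a : ℕ → R, (∀ i ∈ Finset.Icc 1 n, a i ∈ I ^ i) ∧
    x ^ n + ∑ i ∈ Finset.Icc 1 n, a i * x ^ (n - i) = 0

/-- An ideal is integrally closed if it contains every element of `R` that is integral over it. -/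
def Ideal.IsIntegrallyClosedIdeal {R : Type*} [CommRing R] (I : Ideal R) : Prop :=
  ∀ x : R, I.IsIntegralElem x → x ∈ I

/-- An ideal of a local ring is `𝔪`-primary if it is primary and its radical is the maximal
ideal `𝔪`. -/
def Ideal.IsMaximalIdealPrimary {R : Type*} [CommRing R] [IsLocalRing R] (I : Ideal R) : Prop :=
  I.IsPrimary ∧ I.radical = IsLocalRing.maximalIdeal R

/-! Write `𝔪` for the maximal ideal and `k` for the residue field. The substance is that finite
projective dimension of `I` forces regularity. If `𝔪(I : 𝔪) = 𝔪I`, the determinant trick makes `(I :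
𝔪) ∩ 𝔪` integral over `I`, so `I : 𝔪 = I`; this is impossible for a proper `𝔪`-primary ideal. So,
unless `𝔪 = 0`, some `y ∈ I : 𝔪` has `𝔪y ⊄ 𝔪I` (`Ideal.IsIntegrallyClosedIdeal.exists_mul_notMem`).
Prime avoidance then gives a nonzerodivisor `x ∈ 𝔪` with `xy ∉ 𝔪I`, or else a nonzero socle element
of `R`. In the second case finite projective dimension means free, so `I = 0`, and integral
closedness forces `𝔪 = 0`. In the first case the class of `xy` splits `k` off `I/xI`, so `k` has
finite projective dimension over `R/(x)`. By Serre's theorem `R/(x)` is regular, hence so is `R`.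
Serre's theorem itself comes from the same splitting, applied to `𝔪` with `y = 1`. -/

open CategoryTheory IsLocalRing Function

universe u

/-! ### Projective dimension: syzygies, reduction modulo a regular element, nonzero socle. -/

section ProjectiveDimension

variable {R : Type u} [CommRing R]

theorem Module.hasProjectiveDimensionLE_zero_iff {M : Type u} [AddCommGroup M] [Module R M] :
    HasProjectiveDimensionLE (ModuleCat.of R M) 0 ↔ Module.Projective R M := by
  rw [← projective_iff_hasProjectiveDimensionLE_zero, ← IsProjective.iff_projective]

theorem Function.Exact.hasProjectiveDimensionLE_succ_iff {K F M : Type u} [AddCommGroup K]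
    [Module R K] [AddCommGroup F] [Module R F] [AddCommGroup M] [Module R M]
    {f : K →ₗ[R] F} {g : F →ₗ[R] M} (h : Exact f g) (hf : Injective f) (hg : Surjective g)
    [Module.Projective R F] (n : ℕ) :
    HasProjectiveDimensionLE (ModuleCat.of R M) (n + 1) ↔
      HasProjectiveDimensionLE (ModuleCat.of R K) n := by
  have hS : (ModuleCat.shortComplexOfCompEqZero f g h.linearMap_comp_eq_zero).ShortExact :=
    ModuleCat.shortComplex_shortExact _ h hf hg
  exact hS.hasProjectiveDimensionLT_X₃_iff n
    ((IsProjective.iff_projective F).mp inferInstance)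

/-- The obstruction is `Tor₁(M, R/x)`, the `x`-torsion of `M` when `x` is regular on `R`; here it is
bypassed by a direct chase. -/
theorem IsSMulRegular.injective_quotSMulTop_map {K F M : Type*} [AddCommGroup K]
    [Module R K] [AddCommGroup F] [Module R F] [AddCommGroup M] [Module R M] {x : R}
    {f : K →ₗ[R] F} {g : F →ₗ[R] M} (h : Exact f g) (hf : Injective f)
    (hx : IsSMulRegular M x) : Injective (QuotSMulTop.map x f) := by
  rw [injective_iff_map_eq_zero]
  intro k hk
  obtain ⟨k, rfl⟩ := Submodule.Quotient.mk_surjective _ k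
  rw [QuotSMulTop.map_apply_mk, Submodule.Quotient.mk_eq_zero,
    Submodule.mem_smul_pointwise_iff_exists] at hk
  obtain ⟨y, -, hy⟩ := hk
  have hgy : g y = 0 := hx.right_eq_zero_of_smul <| by
    rw [← map_smul, hy, h.apply_apply_eq_zero]
  obtain ⟨z, rfl⟩ := (h y).mp hgy
  rw [← map_smul] at hy
  rw [← hf hy]
  exact (Submodule.Quotient.mk_eq_zero _).mpr (Submodule.smul_mem_pointwise_smul z x ⊤ trivial)

theorem IsSMulRegular.of_submodule {M : Type*} [AddCommGroup M] [Module R M]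
    {x : R} (hx : IsSMulRegular M x) (N : Submodule R M) : IsSMulRegular N x :=
  fun _ _ hab ↦ Subtype.ext (hx (congrArg Subtype.val hab))

theorem IsLocalRing.isLocalRing_quotient_span_singleton [IsLocalRing R] {x : R}
    (hx : x ∈ maximalIdeal R) : IsLocalRing (R ⧸ Ideal.span {x}) :=
  have : Nontrivial (R ⧸ Ideal.span {x}) := Ideal.Quotient.nontrivial_iff.mpr <|
    ((Ideal.span_singleton_le_iff_mem _).mpr hx).trans_lt
      (maximalIdeal.isMaximal R).ne_top.lt_top |>.ne
  .of_surjective' (Ideal.Quotient.mk _) Ideal.Quotient.mk_surjective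

/-- Over a Noetherian local ring, reducing a finite module modulo an element of the maximal ideal
that is regular on the ring and on the module preserves projective dimension. -/
theorem IsSMulRegular.hasProjectiveDimensionLE_quotSMulTop_iff [IsNoetherianRing R]
    [IsLocalRing R] {x : R} (hx : x ∈ maximalIdeal R) (hR : IsSMulRegular R x) (n : ℕ)
    (M : Type u) [AddCommGroup M] [Module R M] [Module.Finite R M] (hM : IsSMulRegular M x) :
    HasProjectiveDimensionLE (ModuleCat.of (R ⧸ Ideal.span {x}) (QuotSMulTop x M)) n ↔
      HasProjectiveDimensionLE (ModuleCat.of R M) n := by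
  have := isLocalRing_quotient_span_singleton hx
  induction n generalizing M with
  | zero =>
    rw [Module.hasProjectiveDimensionLE_zero_iff, Module.hasProjectiveDimensionLE_zero_iff]
    have : Module.Finite (R ⧸ Ideal.span {x}) (QuotSMulTop x M) :=
      .of_restrictScalars_finite R _ _
    have := Module.finitePresentation_of_finite R M
    have key := Module.free_quotSMulTop_iff_free R M (x := x)
      (by rwa [IsLocalRing.jacobson_eq_maximalIdeal _ bot_ne_top]) hM
    refine ⟨fun h ↦ ?_, fun h ↦ ?_⟩
    · have := key.mp Module.free_of_flat_of_isLocalRing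
      infer_instance
    · have := key.mpr Module.free_of_flat_of_isLocalRing
      infer_instance
  | succ n ih =>
    obtain ⟨m, g, hg⟩ := Module.Finite.exists_fin' R M
    have hex : Exact g.ker.subtype g := g.exact_subtype_ker_map
    have hF : IsSMulRegular (Fin m → R) x := IsSMulRegular.pi fun _ ↦ hR
    have hK : IsSMulRegular g.ker x := hF.of_submodule _
    refine Iff.trans ?_ ((ih g.ker hK).trans
      (hex.hasProjectiveDimensionLE_succ_iff Subtype.val_injective hg n).symm)
    let f' := (QuotSMulTop.map x g.ker.subtype).extendScalarsOfSurjective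
      (Ideal.Quotient.mk_surjective (I := Ideal.span {x}))
    let g' := (QuotSMulTop.map x g).extendScalarsOfSurjective
      (Ideal.Quotient.mk_surjective (I := Ideal.span {x}))
    have hex' : Exact f' g' := QuotSMulTop.map_exact x hex hg
    have hinj : Injective (QuotSMulTop.map x g.ker.subtype) :=
      hM.injective_quotSMulTop_map hex Subtype.val_injective
    replace hinj : Injective f' := hinj
    have hsurj : Surjective g' := QuotSMulTop.map_surjective x hg
    have : Module.Free (R ⧸ Ideal.span {x}) (QuotSMulTop x (Fin m → R)) := inferInstance
    have : Module.Projective (R ⧸ Ideal.span {x}) (QuotSMulTop x (Fin m → R)) := .of_free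
    clear_value f' g'
    exact Function.Exact.hasProjectiveDimensionLE_succ_iff hex' hinj hsurj n

open TensorProduct in
theorem Ideal.one_tmul_eq_zero_iff (I : Ideal R) {M : Type*} [AddCommGroup M] [Module R M]
    {v : M} : (1 : R ⧸ I) ⊗ₜ[R] v = 0 ↔ v ∈ I • (⊤ : Submodule R M) := by
  rw [← Submodule.Quotient.mk_eq_zero, ← quotTensorEquivQuotSMul_mk_one_tmul]
  exact ((quotTensorEquivQuotSMul M I).map_eq_zero_iff).symm

/-- If the maximal ideal is annihilated by a nonzero element, then every finite module of finite
projective dimension is free. -/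
theorem Module.free_of_hasProjectiveDimensionLE_of_annihilator [IsNoetherianRing R]
    [IsLocalRing R] {s : R} (hs : s ≠ 0) (hsm : ∀ a ∈ maximalIdeal R, s * a = 0) (n : ℕ)
    (M : Type u) [AddCommGroup M] [Module R M] [Module.Finite R M]
    (h : HasProjectiveDimensionLE (ModuleCat.of R M) n) : Module.Free R M := by
  induction n generalizing M with
  | zero =>
    rw [Module.hasProjectiveDimensionLE_zero_iff] at h
    exact Module.free_of_flat_of_isLocalRing
  | succ n ih =>
    obtain ⟨m, g, hg⟩ := Module.Finite.exists_fin' R M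
    have hex : Exact g.ker.subtype g := g.exact_subtype_ker_map
    rw [hex.hasProjectiveDimensionLE_succ_iff Subtype.val_injective hg] at h
    have := ih _ h
    -- It suffices that the free syzygy `K` satisfies `K ∩ 𝔪F ⊆ 𝔪K`. An element of `𝔪F` is killed by
    -- `s`, so its coordinates in a basis of `K` cannot be units.
    refine Module.free_of_lTensor_residueField_injective g.ker.subtype g hg hex ?_
    rw [injective_iff_map_eq_zero]
    intro t ht
    obtain ⟨v, rfl⟩ := TensorProduct.mk_surjective R g.ker (ResidueField R)
      Ideal.Quotient.mk_surjective t
    have hv : g.ker.subtype v ∈ maximalIdeal R • (⊤ : Submodule R (Fin m → R)) :=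
      (maximalIdeal R).one_tmul_eq_zero_iff.mp ht
    refine (maximalIdeal R).one_tmul_eq_zero_iff.mpr ?_
    have hsv : s • v = 0 := Subtype.ext <| by
      refine Submodule.smul_induction_on (p := fun w ↦ s • w = 0) hv (fun a ha w _ ↦ ?_)
        fun w w' hw hw' ↦ by rw [smul_add, hw, hw', add_zero]
      rw [smul_smul, hsm a ha, zero_smul]
    let b := Module.Free.chooseBasis R g.ker
    rw [← b.sum_repr v]
    refine Submodule.sum_mem _ fun i _ ↦ Submodule.smul_mem_smul ?_ trivial
    rw [mem_maximalIdeal, mem_nonunits_iff]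
    intro hu
    refine hs (hu.mul_left_eq_zero.mp ?_)
    have := congrArg (fun w ↦ b.repr w i) hsv
    simpa using this

end ProjectiveDimension

/-! ### Splitting off the residue field. -/

section Burch

variable {R : Type u} [CommRing R]

/-- An element outside `𝔪N` that is killed by the maximal ideal `𝔪` spans a direct summand of `N`
isomorphic to the residue field. -/
theorem IsLocalRing.hasProjectiveDimensionLE_residueField_of_mem_socle [IsLocalRing R] {N : Type u}
    [AddCommGroup N] [Module R N] {v : N} (hv : ∀ a ∈ maximalIdeal R, a • v = 0)
    (hv' : v ∉ maximalIdeal R • (⊤ : Submodule R N)) (n : ℕ)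
    (h : HasProjectiveDimensionLE (ModuleCat.of R N) n) :
    HasProjectiveDimensionLE (ModuleCat.of R (ResidueField R)) n := by
  let i : ResidueField R →ₗ[R] N :=
    (maximalIdeal R).liftQ (LinearMap.toSpanSingleton R N v) fun a ha ↦ hv a ha
  let : Module (ResidueField R) (N ⧸ maximalIdeal R • (⊤ : Submodule R N)) :=
    inferInstanceAs (Module (R ⧸ maximalIdeal R) _)
  have : IsScalarTower R (ResidueField R) (N ⧸ maximalIdeal R • (⊤ : Submodule R N)) :=
    inferInstanceAs (IsScalarTower R (R ⧸ maximalIdeal R) _)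
  let q := (maximalIdeal R • (⊤ : Submodule R N)).mkQ
  obtain ⟨φ, hφ⟩ : ∃ φ : Module.Dual (ResidueField R) _, φ (q v) ≠ 0 := by
    by_contra! hcon
    exact hv' ((Submodule.Quotient.mk_eq_zero _).mp
      ((Module.forall_dual_apply_eq_zero_iff (ResidueField R) _).mp hcon))
  let r : N →ₗ[R] ResidueField R := (((φ (q v))⁻¹ • φ).restrictScalars R) ∘ₗ q
  have hri : r ∘ₗ i = LinearMap.id := by
    refine Submodule.linearMap_qext _ (LinearMap.ext_ring ?_)
    change (φ (q v))⁻¹ • φ (q ((1 : R) • v)) = 1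
    rw [one_smul, smul_eq_mul, inv_mul_cancel₀ hφ]
  have hret : Retract (ModuleCat.of R (ResidueField R)) (ModuleCat.of R N) :=
    ⟨ModuleCat.ofHom i, ModuleCat.ofHom r, by rw [← ModuleCat.ofHom_comp, hri]; rfl⟩
  exact hret.hasProjectiveDimensionLT (n + 1)

theorem IsLocalRing.maximalIdeal_eq_map_mk (I : Ideal R) [IsLocalRing R] [IsLocalRing (R ⧸ I)] :
    maximalIdeal (R ⧸ I) = (maximalIdeal R).map (Ideal.Quotient.mk I) := by
  have hcomap : (maximalIdeal (R ⧸ I)).comap (Ideal.Quotient.mk I) = maximalIdeal R :=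
    eq_maximalIdeal (Ideal.comap_isMaximal_of_surjective _ Ideal.Quotient.mk_surjective)
  rw [← hcomap, Ideal.map_comap_of_surjective _ Ideal.Quotient.mk_surjective]

/-- Let `J` be an ideal of finite projective dimension of a Noetherian local ring `(R, 𝔪)`. If
`x ∈ 𝔪` is a nonzerodivisor and `x * y ∉ 𝔪J` for some `y ∈ J : 𝔪`, then the residue field
of `R ⧸ (x)` has finite projective dimension over `R ⧸ (x)`. -/
theorem IsLocalRing.hasProjectiveDimensionLE_residueField_quotient [IsNoetherianRing R] [IsLocalRing R]
    (J : Ideal R) {x y : R} (hx : x ∈ maximalIdeal R) (hreg : IsSMulRegular R x)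
    (hy : ∀ a ∈ maximalIdeal R, a * y ∈ J) (hxy : x * y ∉ maximalIdeal R * J) (n : ℕ)
    (h : HasProjectiveDimensionLE (ModuleCat.of R J) n) [IsLocalRing (R ⧸ Ideal.span {x})] :
    HasProjectiveDimensionLE (ModuleCat.of (R ⧸ Ideal.span {x})
      (ResidueField (R ⧸ Ideal.span {x}))) n := by
  have hJ : IsSMulRegular J x := hreg.of_submodule J
  refine hasProjectiveDimensionLE_residueField_of_mem_socle (N := QuotSMulTop x J)
    (v := Submodule.Quotient.mk ⟨x * y, hy x hx⟩) ?_ ?_ n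
    ((hreg.hasProjectiveDimensionLE_quotSMulTop_iff hx n J hJ).mpr h)
  -- Here `a(xy) = x(ay)` with `ay ∈ J`, hence zero in `J/xJ`.
  · intro a ha
    rw [maximalIdeal_eq_map_mk] at ha
    obtain ⟨a, ham, rfl⟩ := (Ideal.mem_map_iff_of_surjective _ Ideal.Quotient.mk_surjective).mp ha
    change Submodule.Quotient.mk (a • (⟨x * y, hy x hx⟩ : J)) = 0
    rw [Submodule.Quotient.mk_eq_zero, Submodule.mem_smul_pointwise_iff_exists]
    refine ⟨⟨a * y, hy a ham⟩, trivial, Subtype.ext ?_⟩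
    simp only [smul_eq_mul, SetLike.mk_smul_mk]
    ring
  · intro hmem
    have key : ∀ w ∈ maximalIdeal (R ⧸ Ideal.span {x}) •
        (⊤ : Submodule (R ⧸ Ideal.span {x}) (QuotSMulTop x J)),
        ∃ z : J, (z : R) ∈ maximalIdeal R * J ∧ Submodule.Quotient.mk z = w := by
      intro w hw
      refine Submodule.smul_induction_on hw (fun a ha w _ ↦ ?_) ?_
      · rw [maximalIdeal_eq_map_mk] at ha
        obtain ⟨a, ham, rfl⟩ :=
          (Ideal.mem_map_iff_of_surjective _ Ideal.Quotient.mk_surjective).mp ha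
        obtain ⟨w, rfl⟩ := Submodule.Quotient.mk_surjective _ w
        exact ⟨a • w, Ideal.mul_mem_mul ham w.2, rfl⟩
      · rintro _ _ ⟨z, hz, rfl⟩ ⟨z', hz', rfl⟩
        exact ⟨z + z', add_mem hz hz', rfl⟩
    obtain ⟨z, hz, hzw⟩ := key _ hmem
    rw [Submodule.Quotient.eq, Submodule.mem_smul_pointwise_iff_exists] at hzw
    obtain ⟨t, -, ht⟩ := hzw
    refine hxy ?_
    have ht' : x * (t : R) = z - x * y := congrArg Subtype.val ht
    rw [show x * y = z - x * (t : R) by rw [ht']; ring]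
    exact sub_mem hz (Ideal.mul_mem_mul hx t.2)

/-- A Noetherian local ring whose maximal ideal consists of zero divisors has an element `s ≠ 0`
killing the maximal ideal. Otherwise the nonzerodivisors in the maximal ideal avoid any given ideal
that does not contain the maximal ideal. -/
theorem IsLocalRing.exists_isSMulRegular_notMem_or_exists_annihilator [IsNoetherianRing R]
    [IsLocalRing R] (C : Ideal R) (hC : ¬ maximalIdeal R ≤ C) :
    (∃ x ∈ maximalIdeal R, IsSMulRegular R x ∧ x ∉ C) ∨
      ∃ s : R, s ≠ 0 ∧ ∀ a ∈ maximalIdeal R, s * a = 0 := by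
  by_cases hall : (maximalIdeal R : Set R) ⊆ ⋃ P ∈ insert C (associatedPrimes R R), (P : Set R)
  · right
    obtain ⟨P, hP, hmP⟩ := (Ideal.subset_union_prime_finite
      -- Prime avoidance tolerates two non-prime members; `C` is the only one needed, so it fills
      -- both slots.
      ((associatedPrimes.finite R R).insert C) (f := id) C C (by
        rintro P (rfl | hP) h _
        · exact (h rfl).elim
        · exact hP.isPrime)).mp hall
    obtain rfl | hP := hP
    · exact (hC hmP).elim
    · obtain ⟨hprime, s, hs⟩ := (isAssociatedPrime_iff).mp ((AssociatedPrimes.mem_iff).mp hP)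
      refine ⟨s, ?_, fun a ha ↦ ?_⟩
      · rintro rfl
        exact hprime.ne_top (by simp [hs])
      · have := hmP ha
        simp only [id, hs, Submodule.mem_colon_singleton] at this
        simpa [mul_comm] using this
  · left
    obtain ⟨x, hx, hx'⟩ := Set.not_subset.mp hall
    simp only [Set.biUnion_insert, Set.mem_union, not_or] at hx'
    refine ⟨x, hx, ?_, hx'.1⟩
    have := hx'.2
    rw [biUnion_associatedPrimes_eq_compl_nonZeroDivisors, Set.mem_compl_iff, not_not] at this
    exact Module.Flat.isSMulRegular_of_nonZeroDivisors this

end Burch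

/-! ### Regular local rings: passage to `R/(x)`, domain property, finite projective dimension. -/

section Regular

variable {R : Type u} [CommRing R] [IsNoetherianRing R] [IsLocalRing R]

theorem IsLocalRing.eq_bot_of_le_maximalIdeal_mul {I : Ideal R} (h : I ≤ maximalIdeal R * I) :
    I = ⊥ :=
  Submodule.eq_bot_of_le_smul_of_le_jacobson_bot (maximalIdeal R) I I.fg_of_isNoetherianRing h
    (by rw [jacobson_eq_maximalIdeal _ bot_ne_top])

theorem IsLocalRing.isRegularLocalRing_of_maximalIdeal_eq_bot (h : maximalIdeal R = ⊥) :
    IsRegularLocalRing R :=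
  .of_spanFinrank_maximalIdeal_le R <| by
    rw [h, Submodule.spanFinrank_bot]
    exact_mod_cast ringKrullDim_nonneg_of_nontrivial

theorem IsLocalRing.spanFinrank_maximalIdeal_le_quotient_add_one (x : R)
    [IsLocalRing (R ⧸ Ideal.span {x})] :
    (maximalIdeal R).spanFinrank ≤ (maximalIdeal (R ⧸ Ideal.span {x})).spanFinrank + 1 := by
  set π := Ideal.Quotient.mk (Ideal.span {x})
  have hπ : Surjective π := Ideal.Quotient.mk_surjective
  have hfg := (maximalIdeal (R ⧸ Ideal.span {x})).fg_of_isNoetherianRing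
  set T := (maximalIdeal (R ⧸ Ideal.span {x})).generators
  have hT : T.Finite := Submodule.FG.finite_generators hfg
  have hspan : Ideal.span (insert x (surjInv hπ '' T)) = maximalIdeal R := by
    have hmap : (Ideal.span (surjInv hπ '' T)).map π = maximalIdeal _ := by
      rw [Ideal.map_span, ← Set.image_comp, (rightInverse_surjInv hπ).comp_eq_id, Set.image_id]
      exact Submodule.span_generators _
    have hcomap : (maximalIdeal (R ⧸ Ideal.span {x})).comap π = maximalIdeal R :=
      eq_maximalIdeal (Ideal.comap_isMaximal_of_surjective _ hπ)
    rw [← hcomap, ← hmap, Ideal.comap_map_of_surjective' π hπ, Ideal.mk_ker, Ideal.span_insert,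
      sup_comm]
  rw [← hspan]
  refine (Submodule.spanFinrank_span_le_ncard_of_finite ((hT.image _).insert x)).trans ?_
  refine (Set.ncard_insert_le _ _).trans (Nat.add_le_add_right ?_ 1)
  exact (Set.ncard_image_le hT).trans (Submodule.FG.generators_ncard hfg).le

theorem IsLocalRing.spanFinrank_maximalIdeal_quotient_add_one_le (x : R)
    (hx : x ∈ maximalIdeal R) (hx' : x ∉ maximalIdeal R * maximalIdeal R)
    [IsLocalRing (R ⧸ Ideal.span {x})] :
    (maximalIdeal (R ⧸ Ideal.span {x})).spanFinrank + 1 ≤ (maximalIdeal R).spanFinrank := by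
  classical
  set π := Ideal.Quotient.mk (Ideal.span {x})
  obtain ⟨s, hcard, hs⟩ :=
    Submodule.FG.exists_span_finset_card_eq_spanFinrank (maximalIdeal R).fg_of_isNoetherianRing
  have hsm : ∀ g ∈ s, g ∈ maximalIdeal R := fun g hg ↦ hs ▸ Submodule.subset_span hg
  obtain ⟨f, -, hf⟩ := Submodule.mem_span_finset.mp (hs ▸ hx : x ∈ Submodule.span R (s : Set R))
  -- Since `x ∉ 𝔪²`, some minimal generator occurs in `x` with unit coefficient and becomes
  -- redundant modulo `x`.
  obtain ⟨g₀, hg₀, hu⟩ : ∃ g ∈ s, IsUnit (f g) := by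
    by_contra! hcon
    exact hx' (hf ▸ Submodule.sum_mem _ fun g hg ↦ Ideal.mul_mem_mul (hcon g hg) (hsm g hg))
  have hmem : π g₀ ∈ Ideal.span (π '' (s.erase g₀ : Finset R)) := by
    have h0 : π (f g₀) * π g₀ + ∑ g ∈ s.erase g₀, π (f g) * π g = 0 := by
      rw [Finset.add_sum_erase s (fun g ↦ π (f g) * π g) hg₀]
      have : π x = 0 := Ideal.Quotient.eq_zero_iff_mem.mpr (Ideal.mem_span_singleton_self x)
      simpa using (congrArg π hf).trans this
    rw [← Ideal.unit_mul_mem_iff_mem _ (hu.map π), eq_neg_of_add_eq_zero_left h0]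
    exact neg_mem (sum_mem fun g hg ↦ Ideal.mul_mem_left _ _
      (Ideal.subset_span (Set.mem_image_of_mem π hg)))
  have hspan : Ideal.span (π '' (s.erase g₀ : Finset R)) = maximalIdeal _ := by
    have hs' : Ideal.span (s : Set R) = maximalIdeal R := hs
    rw [maximalIdeal_eq_map_mk, ← hs', Ideal.map_span]
    refine le_antisymm (Ideal.span_mono (Set.image_mono (by simp))) (Ideal.span_le.mpr ?_)
    rintro _ ⟨g, hg, rfl⟩
    by_cases h : g = g₀
    · exact h ▸ hmem
    · exact Ideal.subset_span ⟨g, by simpa using ⟨hg, h⟩, rfl⟩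
  rw [← hspan, ← hcard, ← Finset.card_erase_add_one hg₀]
  refine Nat.add_le_add_right ?_ 1
  refine (Submodule.spanFinrank_span_le_ncard_of_finite
    ((s.erase g₀).finite_toSet.image π)).trans ?_
  exact (Set.ncard_image_le (s.erase g₀).finite_toSet).trans (Set.ncard_coe_finset _).le

open Pointwise in
theorem IsLocalRing.ringKrullDim_le_quotient_span_singleton_add_one {x : R}
    (hx : x ∈ maximalIdeal R) : ringKrullDim R ≤ ringKrullDim (R ⧸ Ideal.span {x}) + 1 := by
  have h : Ideal.span {x} = x • (⊤ : Ideal R) := by simp [← Submodule.ideal_span_singleton_smul]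
  rw [ringKrullDim_eq_of_ringEquiv (Ideal.quotEquivOfEq h)]
  exact ringKrullDim_le_ringKrullDim_quotSMulTop_succ hx

theorem IsRegularLocalRing.of_quotient_span_singleton {x : R} (hx : x ∈ maximalIdeal R)
    (hreg : IsSMulRegular R x) (h : IsRegularLocalRing (R ⧸ Ideal.span {x})) :
    IsRegularLocalRing R := by
  refine .of_spanFinrank_maximalIdeal_le R ?_
  rw [← ringKrullDim_quotient_span_singleton_succ_eq_ringKrullDim hreg hx,
    ← h.spanFinrank_maximalIdeal]
  exact_mod_cast spanFinrank_maximalIdeal_le_quotient_add_one x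

theorem IsRegularLocalRing.quotient_span_singleton (h : IsRegularLocalRing R) {x : R}
    (hx : x ∈ maximalIdeal R) (hx' : x ∉ maximalIdeal R * maximalIdeal R) :
    IsRegularLocalRing (R ⧸ Ideal.span {x}) := by
  have := isLocalRing_quotient_span_singleton hx
  refine .of_spanFinrank_maximalIdeal_le _ ?_
  have h1 := ringKrullDim_le_quotient_span_singleton_add_one hx
  rw [← h.spanFinrank_maximalIdeal] at h1
  have h2 : (((maximalIdeal (R ⧸ Ideal.span {x})).spanFinrank + 1 : ℕ) : WithBot ℕ∞) ≤
      (maximalIdeal R).spanFinrank :=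
    Nat.cast_le.mpr (spanFinrank_maximalIdeal_quotient_add_one_le x hx hx')
  have h3 := h2.trans h1
  rw [Nat.cast_add, Nat.cast_one] at h3
  exact (ENat.WithBot.add_le_add_natCast_right_iff (c := 1)).mp (by simpa using h3)

theorem IsLocalRing.not_maximalIdeal_le_mul_self
    (h : maximalIdeal R ≠ ⊥) : ¬ maximalIdeal R ≤ maximalIdeal R * maximalIdeal R :=
  fun hle ↦ h (eq_bot_of_le_maximalIdeal_mul hle)

/-- Choose `x ∈ 𝔪` outside `𝔪²` and all minimal primes. By induction `(x)` is prime, so it contains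
a minimal prime `p`; as `x ∉ p`, `p = xp`, and Nakayama gives `p = 0`. -/
theorem IsRegularLocalRing.isDomain_of_spanFinrank_le (d : ℕ) (R : Type u) [CommRing R]
    [IsRegularLocalRing R] (hd : (maximalIdeal R).spanFinrank ≤ d) : IsDomain R := by
  induction d generalizing R with
  | zero =>
    have hbot : maximalIdeal R = ⊥ := (Submodule.spanFinrank_eq_zero_iff_eq_bot
      (maximalIdeal R).fg_of_isNoetherianRing).mp (Nat.le_zero.mp hd)
    exact ((isField_iff_maximalIdeal_eq).mpr hbot).isDomain
  | succ d ih =>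
    by_cases hbot : maximalIdeal R = ⊥
    · exact ((isField_iff_maximalIdeal_eq).mpr hbot).isDomain
    have hne : ¬ ((maximalIdeal R : Set R) ⊆
        ⋃ P ∈ insert (maximalIdeal R * maximalIdeal R) (minimalPrimes R), (P : Set R)) := by
      intro hall
      obtain ⟨P, hP, hmP⟩ := (Ideal.subset_union_prime_finite
        ((minimalPrimes.finite_of_isNoetherianRing R).insert _) (f := id)
        (maximalIdeal R * maximalIdeal R) ⊥ (by
          rintro P (rfl | hP) h _
          · exact (h rfl).elim
          · exact hP.1.1)).mp hall
      obtain rfl | hP := hP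
      · exact not_maximalIdeal_le_mul_self hbot hmP
      · have hPm : maximalIdeal R = P := (maximalIdeal.isMaximal R).eq_of_le hP.1.1.ne_top hmP
        have hh : (maximalIdeal R).height = 0 := by
          rw [Ideal.height_eq_zero_iff, hPm]
          exact hP
        have hdim := maximalIdeal_height_eq_ringKrullDim (R := R)
        rw [hh, ← IsRegularLocalRing.spanFinrank_maximalIdeal] at hdim
        refine hbot ((Submodule.spanFinrank_eq_zero_iff_eq_bot
          (maximalIdeal R).fg_of_isNoetherianRing).mp ?_)
        exact_mod_cast hdim.symm
    obtain ⟨x, hx, hx'⟩ := Set.not_subset.mp hne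
    simp only [Set.biUnion_insert, Set.mem_union, not_or, Set.mem_iUnion, not_exists] at hx'
    have hreg := IsRegularLocalRing.quotient_span_singleton ‹_› hx hx'.1
    have hrank := spanFinrank_maximalIdeal_quotient_add_one_le x hx hx'.1
    have hdom := ih (R ⧸ Ideal.span {x}) (by omega)
    have hprime : (Ideal.span {x}).IsPrime := Ideal.Quotient.isDomain_iff_prime _ |>.mp hdom
    obtain ⟨p, hp, hpx⟩ := Ideal.exists_minimalPrimes_le (I := ⊥) (J := Ideal.span {x}) bot_le
    have hxp : x ∉ p := hx'.2 p hp
    have hpbot : p = ⊥ := eq_bot_of_le_maximalIdeal_mul fun z hz ↦ by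
      obtain ⟨w, rfl⟩ := Ideal.mem_span_singleton'.mp (hpx hz)
      rw [mul_comm w]
      exact Ideal.mul_mem_mul hx ((hp.1.1.mem_or_mem hz).resolve_right hxp)
    have : (⊥ : Ideal R).IsPrime := hpbot ▸ hp.1.1
    exact .of_bot_isPrime R

theorem IsRegularLocalRing.isDomain (R : Type u) [CommRing R] [IsRegularLocalRing R] :
    IsDomain R :=
  isDomain_of_spanFinrank_le _ R le_rfl

omit [IsNoetherianRing R] in
theorem Module.hasProjectiveDimensionLE_zero_of_maximalIdeal_eq_bot (hbot : maximalIdeal R = ⊥)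
    (M : Type u) [AddCommGroup M] [Module R M] :
    HasProjectiveDimensionLE (ModuleCat.of R M) 0 := by
  let := ((isField_iff_maximalIdeal_eq).mpr hbot).toField
  rw [Module.hasProjectiveDimensionLE_zero_iff]
  infer_instance

/-- Finite modules over a regular local ring have finite projective dimension. -/
theorem IsRegularLocalRing.hasProjectiveDimensionLE (d : ℕ) (R : Type u) [CommRing R]
    [IsRegularLocalRing R] (hd : (maximalIdeal R).spanFinrank ≤ d) (M : Type u) [AddCommGroup M]
    [Module R M] [Module.Finite R M] : HasProjectiveDimensionLE (ModuleCat.of R M) d := by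
  induction d generalizing R M with
  | zero =>
    exact Module.hasProjectiveDimensionLE_zero_of_maximalIdeal_eq_bot
      ((Submodule.spanFinrank_eq_zero_iff_eq_bot
      (maximalIdeal R).fg_of_isNoetherianRing).mp (Nat.le_zero.mp hd)) M
  | succ d ih =>
    by_cases hbot : maximalIdeal R = ⊥
    · have := Module.hasProjectiveDimensionLE_zero_of_maximalIdeal_eq_bot hbot M
      exact hasProjectiveDimensionLT_of_ge _ (0 + 1) (d + 1 + 1) (by omega)
    obtain ⟨x, hx, hx'⟩ := SetLike.not_le_iff_exists.mp (not_maximalIdeal_le_mul_self hbot)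
    have := isDomain R
    have hreg : IsSMulRegular R x := Module.Flat.isSMulRegular_of_nonZeroDivisors
      (mem_nonZeroDivisors_of_ne_zero fun h ↦ hx' (h ▸ zero_mem _))
    have := IsRegularLocalRing.quotient_span_singleton ‹_› hx hx'
    have hrank := spanFinrank_maximalIdeal_quotient_add_one_le x hx hx'
    obtain ⟨m, g, hg⟩ := Module.Finite.exists_fin' R M
    -- `M` may have `x`-torsion, but its syzygy lies in a free module, so `x` is regular on it.
    rw [g.exact_subtype_ker_map.hasProjectiveDimensionLE_succ_iff Subtype.val_injective hg]
    have hF : IsSMulRegular (Fin m → R) x := IsSMulRegular.pi fun _ ↦ hreg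
    have : Module.Finite (R ⧸ Ideal.span {x}) (QuotSMulTop x g.ker) :=
      .of_restrictScalars_finite R _ _
    exact (hreg.hasProjectiveDimensionLE_quotSMulTop_iff hx d g.ker (hF.of_submodule _)).mp
      (ih (R ⧸ Ideal.span {x}) (by omega) _)

end Regular

/-! ### Serre's theorem and ideals with `𝔪(J : 𝔪) ≠ 𝔪J`. -/

section Serre

variable {R : Type u} [CommRing R] [IsNoetherianRing R] [IsLocalRing R]

theorem CategoryTheory.projectiveDimension_lt_top_iff {C : Type*} [Category C] [Abelian C] {X : C} :
    projectiveDimension X < ⊤ ↔ ∃ n, HasProjectiveDimensionLE X n := by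
  rw [lt_top_iff_ne_top, projectiveDimension_ne_top_iff]

/-- If the maximal ideal is annihilated by a nonzero element, an ideal `I` such that `R ⧸ I` has
finite projective dimension is trivial. -/
theorem IsLocalRing.eq_bot_of_hasProjectiveDimensionLE_quotient {I : Ideal R} (hI : I ≠ ⊤) {s : R}
    (hs : s ≠ 0) (hsm : ∀ a ∈ maximalIdeal R, s * a = 0) (n : ℕ)
    (h : HasProjectiveDimensionLE (ModuleCat.of R (R ⧸ I)) n) : I = ⊥ := by
  have := Module.free_of_hasProjectiveDimensionLE_of_annihilator hs hsm n _ h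
  have : Nontrivial (R ⧸ I) := Ideal.Quotient.nontrivial_iff.mpr hI
  rw [← Ideal.annihilator_quotient (I := I), Module.annihilator_eq_bot]
  infer_instance

omit [IsNoetherianRing R] [IsLocalRing R] in
theorem Ideal.hasProjectiveDimensionLE_quotient_succ_iff (I : Ideal R) (n : ℕ) :
    HasProjectiveDimensionLE (ModuleCat.of R (R ⧸ I)) (n + 1) ↔
      HasProjectiveDimensionLE (ModuleCat.of R I) n :=
  (LinearMap.exact_subtype_mkQ I).hasProjectiveDimensionLE_succ_iff Subtype.val_injective
    (Submodule.mkQ_surjective I) n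

/-- Let `J` be a proper ideal with `𝔪 * (J : 𝔪) ≠ 𝔪 * J` and finite projective dimension over a
Noetherian local ring `(R, 𝔪)`. Then either `J = 0`, or there is a nonzerodivisor
`x ∈ 𝔪` such that the residue field of `R ⧸ (x)` has finite projective dimension; moreover `x` may
be taken with `x * y ∉ 𝔪J`. -/
theorem IsLocalRing.eq_bot_or_exists_hasProjectiveDimensionLE_residueField {J : Ideal R}
    (hJ : J ≠ ⊤) {y : R} (hy : ∀ a ∈ maximalIdeal R, a * y ∈ J)
    (hy' : ∃ a ∈ maximalIdeal R, a * y ∉ maximalIdeal R * J) (n : ℕ)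
    (h : HasProjectiveDimensionLE (ModuleCat.of R J) n) :
    J = ⊥ ∨ ∃ (x : R) (_ : x ∈ maximalIdeal R) (_ : IsLocalRing (R ⧸ Ideal.span {x})),
      IsSMulRegular R x ∧ x * y ∉ maximalIdeal R * J ∧
      HasProjectiveDimensionLE (ModuleCat.of (R ⧸ Ideal.span {x})
        (IsLocalRing.ResidueField (R ⧸ Ideal.span {x}))) n := by
  let C : Ideal R := Submodule.comap (LinearMap.mulRight R y) (maximalIdeal R * J)
  have hC : ¬ maximalIdeal R ≤ C := SetLike.not_le_iff_exists.mpr hy'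
  obtain ⟨x, hx, hreg, hxC⟩ | ⟨s, hs, hsm⟩ :=
    exists_isSMulRegular_notMem_or_exists_annihilator C hC
  · have := isLocalRing_quotient_span_singleton hx
    exact .inr ⟨x, hx, this, hreg, hxC,
      hasProjectiveDimensionLE_residueField_quotient J hx hreg hy hxC n h⟩
  · exact .inl (eq_bot_of_hasProjectiveDimensionLE_quotient hJ hs hsm (n + 1)
      ((J.hasProjectiveDimensionLE_quotient_succ_iff n).mpr h))

/-- **Serre's theorem**: a Noetherian local ring whose residue field has finite projective dimension
is regular. -/
theorem IsRegularLocalRing.of_hasProjectiveDimensionLE_residueField (d n : ℕ) (R : Type u)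
    [CommRing R] [IsNoetherianRing R] [IsLocalRing R] (hd : (maximalIdeal R).spanFinrank ≤ d)
    (h : HasProjectiveDimensionLE (ModuleCat.of R (IsLocalRing.ResidueField R)) n) :
    IsRegularLocalRing R := by
  induction d generalizing R with
  | zero =>
    exact isRegularLocalRing_of_maximalIdeal_eq_bot ((Submodule.spanFinrank_eq_zero_iff_eq_bot
      (maximalIdeal R).fg_of_isNoetherianRing).mp (Nat.le_zero.mp hd))
  | succ d ih =>
    by_cases hbot : maximalIdeal R = ⊥
    · exact isRegularLocalRing_of_maximalIdeal_eq_bot hbot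
    have hm : HasProjectiveDimensionLE (ModuleCat.of R (maximalIdeal R)) n :=
      ((maximalIdeal R).hasProjectiveDimensionLE_quotient_succ_iff n).mp
        (hasProjectiveDimensionLT_of_ge (ModuleCat.of R (IsLocalRing.ResidueField R)) (n + 1) _
          (by omega))
    obtain hbot' | ⟨x, hx, _, hreg, hxm, hpd⟩ :=
      -- With `y = 1` the condition on `x` reads `x ∉ 𝔪²`, so the embedding dimension drops.
      eq_bot_or_exists_hasProjectiveDimensionLE_residueField (J := maximalIdeal R) (y := 1)
        (maximalIdeal.isMaximal R).ne_top (fun a ha ↦ by rwa [mul_one])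
        (by simpa using SetLike.not_le_iff_exists.mp (not_maximalIdeal_le_mul_self hbot)) n hm
    · exact (hbot hbot').elim
    · have hrank := spanFinrank_maximalIdeal_quotient_add_one_le x hx (by rwa [mul_one] at hxm)
      exact .of_quotient_span_singleton hx hreg (ih (R ⧸ Ideal.span {x}) (by omega) hpd)

/-- An ideal `J` of finite projective dimension with `𝔪 * (J : 𝔪) ≠ 𝔪 * J` forces `J = 0` or the
ring to be regular. -/
theorem IsRegularLocalRing.of_hasProjectiveDimensionLE_ideal {J : Ideal R}
    (hJ : J ≠ ⊤) {y : R} (hy : ∀ a ∈ maximalIdeal R, a * y ∈ J)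
    (hy' : ∃ a ∈ maximalIdeal R, a * y ∉ maximalIdeal R * J) (n : ℕ)
    (h : HasProjectiveDimensionLE (ModuleCat.of R J) n) : J = ⊥ ∨ IsRegularLocalRing R := by
  refine (eq_bot_or_exists_hasProjectiveDimensionLE_residueField hJ hy hy' n h).imp_right ?_
  rintro ⟨x, hx, _, hreg, -, hpd⟩
  exact .of_quotient_span_singleton hx hreg
    (.of_hasProjectiveDimensionLE_residueField _ n _ le_rfl hpd)

end Serre

/-! ### Integral closure and the colon ideal `I : 𝔪`. -/

section IntegrallyClosed

variable {R : Type u} [CommRing R]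

open Polynomial in
theorem Ideal.isIntegralElem_of_monic {I : Ideal R} {y : R} (p : R[X]) (hp : p.Monic)
    (hdeg : 1 ≤ p.natDegree) (hcoeff : ∀ k, p.coeff k ∈ I ^ (p.natDegree - k))
    (h : p.eval y = 0) : I.IsIntegralElem y := by
  refine ⟨p.natDegree, hdeg, fun i ↦ p.coeff (p.natDegree - i), fun i hi ↦ ?_, ?_⟩
  · have := hcoeff (p.natDegree - i)
    rwa [Nat.sub_sub_self (Finset.mem_Icc.mp hi).2] at this
  · rw [← h, eval_eq_sum_range, ← Finset.sum_range_reflect, Finset.sum_range_succ']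
    simp only [Nat.add_sub_cancel, Nat.sub_zero, hp.coeff_natDegree, one_mul]
    rw [add_comm, Finset.range_eq_Ico,
      Finset.sum_Ico_add' (fun i ↦ p.coeff (p.natDegree - i) * y ^ (p.natDegree - i))]
    rfl

open Polynomial in
/-- If `y ∈ M` and `y * M ⊆ I * M` for a finitely generated ideal `M`, then `y` is integral
over `I`. -/
theorem Ideal.isIntegralElem_of_mul_mem {I M : Ideal R} (hM : M.FG) {y : R} (hyM : y ∈ M)
    (h : ∀ a ∈ M, a * y ∈ M * I) : I.IsIntegralElem y := by
  have : Module.Finite R M := Module.Finite.iff_fg.mpr hM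
  have hrange : LinearMap.range (LinearMap.lsmul R M y) ≤ I • ⊤ := by
    rintro _ ⟨a, rfl⟩
    have h1 : ((y • a : M) : R) ∈ (I • (⊤ : Submodule R M)).map M.subtype := by
      rw [Submodule.map_smul'', Submodule.map_top, Submodule.range_subtype, smul_eq_mul,
        mul_comm I, Submodule.coe_smul, smul_eq_mul, mul_comm y]
      exact h a a.2
    obtain ⟨b, hb, hab⟩ := h1
    rwa [show b = LinearMap.lsmul R M y a from Subtype.ext hab] at hb
  obtain ⟨p, hp, -, hcoeff, h0⟩ :=
    LinearMap.exists_monic_and_natDegree_eq_and_coeff_mem_pow_and_aeval_eq_zero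
      R (LinearMap.lsmul R M y) I hrange
  cases subsingleton_or_nontrivial R
  · exact ⟨1, le_rfl, 0, by simp, Subsingleton.elim _ _⟩
  -- `M` need not be faithful, so `p(y)` may be nonzero; but it kills `y ∈ M`, whence the factor
  -- `X`.
  refine isIntegralElem_of_monic (p * X) (hp.mul monic_X) ?_ ?_ ?_
  · rw [hp.natDegree_mul monic_X, natDegree_X]
    omega
  · intro k
    rw [hp.natDegree_mul monic_X, natDegree_X]
    cases k with
    | zero => simp
    | succ k =>
      rw [coeff_mul_X, Nat.add_sub_add_right]
      exact hcoeff k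
  · rw [eval_mul, eval_X]
    have h1 : aeval (LinearMap.lsmul R M y) p = LinearMap.lsmul R M (p.eval y) := by
      have := aeval_algHom_apply (Algebra.lsmul R R M) y p
      rw [coe_aeval_eq_eval] at this
      exact this
    have h2 := congrArg Subtype.val (LinearMap.congr_fun (h1.symm.trans h0) ⟨y, hyM⟩)
    exact h2

variable [IsNoetherianRing R] [IsLocalRing R]

/-- An integrally closed `𝔪`-primary ideal `I` satisfies `𝔪 * (I : 𝔪) ≠ 𝔪 * I`, unless `𝔪 = 0`. -/
theorem Ideal.IsIntegrallyClosedIdeal.exists_mul_notMem {I : Ideal R}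
    (hclosed : I.IsIntegrallyClosedIdeal) (hprimary : I.IsMaximalIdealPrimary)
    (hm : maximalIdeal R ≠ ⊥) :
    ∃ y, (∀ a ∈ maximalIdeal R, a * y ∈ I) ∧ ∃ a ∈ maximalIdeal R, a * y ∉ maximalIdeal R * I := by
  by_contra! hcon
  have hItop : I ≠ ⊤ := hprimary.1.ne_top
  have hIm : I ≤ maximalIdeal R := le_maximalIdeal hItop
  have hcolon : ∀ y, (∀ a ∈ maximalIdeal R, a * y ∈ I) → y ∈ I := by
    intro y hy
    by_cases hym : y ∈ maximalIdeal R
    · exact hclosed y (isIntegralElem_of_mul_mem (maximalIdeal R).fg_of_isNoetherianRing hym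
        (hcon y hy))
    · have hu : IsUnit y := by simpa using hym
      have hmI : maximalIdeal R ≤ I := fun a ha ↦ (I.mul_unit_mem_iff_mem hu).mp (hy a ha)
      have hIeq : I = maximalIdeal R := le_antisymm hIm hmI
      refine (not_maximalIdeal_le_mul_self hm fun a ha ↦ ?_).elim
      have := hcon y hy a ha
      rw [hIeq] at this
      exact ((maximalIdeal R * maximalIdeal R).mul_unit_mem_iff_mem hu).mp this
  obtain ⟨k, hk⟩ := Ideal.exists_pow_le_of_le_radical_of_fg (J := I) (I := maximalIdeal R)
    hprimary.2.ge (maximalIdeal R).fg_of_isNoetherianRing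
  -- Once `I : 𝔪 = I`, the inclusion `𝔪 ^ (j + 1) ≤ I` descends to `𝔪 ^ j ≤ I`, down to `j = 0`.
  have hall : ∀ j, maximalIdeal R ^ j ≤ I → I = ⊤ := by
    intro j
    induction j with
    | zero => intro h; simpa using h
    | succ j ih =>
      refine fun h ↦ ih fun y hy ↦ hcolon y fun a ha ↦ h ?_
      rw [pow_succ']
      exact Ideal.mul_mem_mul ha hy
  exact hItop (hall k hk)

end IntegrallyClosed

theorem mainTheorem3 {R : Type*} [CommRing R] [IsNoetherianRing R] [IsLocalRing R]
    (I : Ideal R) (hclosed : I.IsIntegrallyClosedIdeal) (hprimary : I.IsMaximalIdealPrimary) :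
    (IsRegularLocalRing R ↔
      CategoryTheory.projectiveDimension (ModuleCat.of R I) < ⊤) ∧
    (CategoryTheory.projectiveDimension (ModuleCat.of R I) < ⊤ ↔
      CategoryTheory.projectiveDimension (ModuleCat.of R (R ⧸ I)) < ⊤) := by
  simp only [projectiveDimension_lt_top_iff]
  refine ⟨⟨fun _ ↦ ⟨_, IsRegularLocalRing.hasProjectiveDimensionLE _ R le_rfl I⟩, ?_⟩, ?_, ?_⟩
  · rintro ⟨n, hn⟩
    by_cases hm : maximalIdeal R = ⊥
    · exact isRegularLocalRing_of_maximalIdeal_eq_bot hm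
    obtain ⟨y, hy, hy'⟩ := hclosed.exists_mul_notMem hprimary hm
    refine (IsRegularLocalRing.of_hasProjectiveDimensionLE_ideal hprimary.1.ne_top hy hy' n
      hn).resolve_left ?_
    rintro rfl
    -- If `I = 0`, then `𝔪` is the nilradical, and nilpotents are integral over `0`.
    refine hm ((le_bot_iff).mp fun a ha ↦ hclosed a ?_)
    rw [← hprimary.2] at ha
    obtain ⟨k, hk⟩ := ha
    rw [Ideal.mem_bot] at hk
    exact ⟨k + 1, by omega, 0, by simp, by simp [pow_succ, hk]⟩
  · rintro ⟨n, hn⟩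
    exact ⟨n + 1, (I.hasProjectiveDimensionLE_quotient_succ_iff n).mpr hn⟩
  · rintro ⟨n, hn⟩
    exact ⟨n, (I.hasProjectiveDimensionLE_quotient_succ_iff n).mp
      (hasProjectiveDimensionLT_of_ge _ (n + 1) _ (by omega))⟩
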